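/- Let $k$ be a field and $V$ a $k$-vector space of finite dimension $n\ge 1$ with basis $(x_1,\dots,x_n)$. Let $N\ge 2$, let $f=x_{i_1}\cdots x_{i_N}\in V^{\otimes N}$ be a monomial of degree $N$, let $R=kf\subseteq V^{\otimes N}$ be the line spanned by $f$, and let $A=A(V,R)=T(V)/I(R)$, where $T(V)$ is the tensor algebra and $I(R)$ is the two-sided ideal generated by $R$. For $m\ge 0$ put $W_m=\bigcap_{i+N+j=m}V^{\otimes i}\otimes R\otimes V^{\otimes j}\subseteq V^{\otimes m}$ (so that $W_m=V^{\otimes m}$ for $m<N$), and put $\nu(2i)=Ni$, $\nu(2i+1)=Ni+1$. The Koszul complex $K(A)$ has the terms $K_i=A\otimes_k W_{\nu(i)}$, $i\ge 0$, and its differential $\delta_i:K_i\to K_{i-1}$ is the left $A$-linear map that is given on $W_{\nu(i)}$ by the inclusion $W_{\nu(i)}\subseteq V^{\otimes(\nu(i)-\nu(i-1))}\otimes W_{\nu(i-1)}$ followed by the canonical map $V^{\otimes(\nu(i)-\nu(i-1))}\to A$ on the first factor. The algebra $A$ is called $N$-Koszul if the homology of $K(A)$ is $0$ in every degree $i>0$.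 Then $A$ is $N$-Koszul if and only if there is no $m\in\{2,\dots,N-1\}$ such that $i_1,\dots,i_m$ are not all equal and $$f=(x_{i_1}\cdots x_{i_m})^q\,x_{i_1}\cdots x_{i_r},$$ where $N=mq+r$, $0\le r<m$, is the division of $N$ by $m$ with remainder. -/

import Mathlib

open scoped TensorProduct

noncomputable section

namespace NKoszul

variable (k : Type*) [Field k] (V : Type*) [AddCommGroup V] [Module k V]

/-- `V^{⊗ m}`, as the subspace of the tensor algebra `T(V)` spanned by products of `m` vectors.
Products of subspaces of `T(V)` play the role of tensor products: for subspaces `P ⊆ V^{⊗ m}` and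
`Q ⊆ T(V)` the multiplication `P ⊗ Q → P * Q` is bijective. -/
def tpow (m : ℕ) : Submodule k (TensorAlgebra k V) :=
  LinearMap.range (TensorAlgebra.ι k : V →ₗ[k] TensorAlgebra k V) ^ m

theorem tpow_add (a b : ℕ) : tpow k V (a + b) = tpow k V a * tpow k V b := pow_add _ _ _

theorem tensorAlgebra_apply {κ : Type*} (b : Module.Basis κ k V) (w : FreeMonoid κ) :
    b.tensorAlgebra w = (w.toList.map fun i => TensorAlgebra.ι k (b i)).prod := by
  have h : b.tensorAlgebra w =
      (TensorAlgebra.equivFreeAlgebra b).symm (FreeAlgebra.basisFreeMonoid k κ w) := rfl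
  have h2 : FreeAlgebra.basisFreeMonoid k κ w = (w.toList.map (FreeAlgebra.ι k)).prod := by
    have : FreeAlgebra.basisFreeMonoid k κ w =
      FreeAlgebra.equivMonoidAlgebraFreeMonoid.symm (MonoidAlgebra.of k _ w) := rfl
    rw [this]
    simp [FreeAlgebra.equivMonoidAlgebraFreeMonoid, FreeMonoid.lift_apply]
  rw [h, h2, map_list_prod, List.map_map]
  congr 1
  apply List.map_congr_left
  intro i _
  simp

theorem tensorAlgebra_mul {κ : Type*} (b : Module.Basis κ k V) (v w : FreeMonoid κ) :
    b.tensorAlgebra (v * w) = b.tensorAlgebra v * b.tensorAlgebra w := by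
  simp [tensorAlgebra_apply]

theorem tpow_eq_span {κ : Type*} (b : Module.Basis κ k V) (m : ℕ) :
    tpow k V m = Submodule.span k
      (Set.range fun w : {w : FreeMonoid κ // w.length = m} => b.tensorAlgebra w.1) := by
  induction m with
  | zero =>
    rw [tpow, pow_zero, Submodule.one_eq_span]
    congr 1
    ext t
    simp only [Set.mem_singleton_iff, Set.mem_range, Subtype.exists]
    constructor
    · rintro rfl
      exact ⟨1, rfl, by simp [tensorAlgebra_apply]⟩
    · rintro ⟨w, hw, rfl⟩
      rw [FreeMonoid.length_eq_zero] at hw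
      subst hw
      simp [tensorAlgebra_apply]
  | succ m ih =>
    have h1 : LinearMap.range (TensorAlgebra.ι k : V →ₗ[k] TensorAlgebra k V) =
        Submodule.span k (Set.range fun i => TensorAlgebra.ι k (b i)) := by
      rw [LinearMap.range_eq_map, ← b.span_eq, Submodule.map_span, ← Set.range_comp]
      rfl
    have h2 : tpow k V (m + 1) = tpow k V m *
        LinearMap.range (TensorAlgebra.ι k : V →ₗ[k] TensorAlgebra k V) := pow_succ _ _
    rw [h2, ih, h1, Submodule.span_mul_span]
    congr 1
    ext t
    simp only [Set.mem_mul, Set.mem_range, Subtype.exists]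
    constructor
    · rintro ⟨_, ⟨w, hw, rfl⟩, _, ⟨i, rfl⟩, rfl⟩
      refine ⟨w * FreeMonoid.of i, by simp [hw], ?_⟩
      simp [tensorAlgebra_apply]
    · rintro ⟨w, hw, rfl⟩
      have hne : w.toList ≠ [] := by
        intro h
        have : w.length = 0 := by rw [FreeMonoid.length, h]; rfl
        omega
      obtain ⟨l, i, hl⟩ := List.eq_nil_or_concat w.toList |>.resolve_left hne
      have hlen : l.length = m := by
        have : w.toList.length = m + 1 := hw
        rw [hl] at this
        simpa using this
      refine ⟨_, ⟨FreeMonoid.ofList l, hlen, rfl⟩, _, ⟨i, rfl⟩, ?_⟩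
      simp [tensorAlgebra_apply, hl]

/-- The multiplication map `V^{⊗ d} ⊗ T(V) → T(V)` is injective. -/
theorem tpow_linearDisjoint_top (d : ℕ) :
    (tpow k V d).LinearDisjoint (⊤ : Submodule k (TensorAlgebra k V)) := by
  let b := Module.Basis.ofVectorSpace k V
  have hli : LinearIndependent k (fun w :
      {w : FreeMonoid (Module.Basis.ofVectorSpaceIndex k V) // w.length = d} =>
      b.tensorAlgebra w.1) :=
    b.tensorAlgebra.linearIndependent.comp _ Subtype.val_injective
  let m := (Module.Basis.span hli).map (LinearEquiv.ofEq _ _ (tpow_eq_span k V b d).symm)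
  have hm : ∀ w, (m w : TensorAlgebra k V) = b.tensorAlgebra w.1 := fun w => by
    simp [m, Module.Basis.span_apply]
  let n := b.tensorAlgebra.map (Submodule.topEquiv (R := k) (M := TensorAlgebra k V)).symm
  have hn : ∀ w, (n w : TensorAlgebra k V) = b.tensorAlgebra w := fun w => by simp [n]
  refine Submodule.LinearDisjoint.of_basis_mul _ _ m n ?_
  simp only [hm, hn, ← tensorAlgebra_mul]
  refine b.tensorAlgebra.linearIndependent.comp
    (fun i : {w : FreeMonoid _ // w.length = d} × FreeMonoid _ => i.1.1 * i.2) ?_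
  rintro ⟨⟨v, hv⟩, w⟩ ⟨⟨v', hv'⟩, w'⟩ h
  have h' : v.toList ++ w.toList = v'.toList ++ w'.toList := congrArg FreeMonoid.toList h
  obtain ⟨h1, h2⟩ := List.append_inj h' (hv.trans hv'.symm)
  have h1' : v = v' := h1
  have h2' : w = w' := h2
  subst h1' h2'
  rfl

theorem tpow_linearDisjoint (d : ℕ) (U : Submodule k (TensorAlgebra k V)) :
    (tpow k V d).LinearDisjoint U :=
  (tpow_linearDisjoint_top k V d).of_le_right_of_flat le_top

variable {k V}

/-- If `t` lies in `V^{⊗ d} * U` for every member `U` of a nonempty family, then it lies in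
`V^{⊗ d} * ⨅ U`. -/
theorem mem_tpow_mul_iInf {J : Type*} [Nonempty J] (d : ℕ)
    (U : J → Submodule k (TensorAlgebra k V)) (t : TensorAlgebra k V)
    (h : ∀ j, t ∈ tpow k V d * U j) : t ∈ tpow k V d * ⨅ j, U j := by
  let m := Module.Basis.ofVectorSpace k (tpow k V d)
  have hinj : Function.Injective
      (Submodule.mulLeftMap (⊤ : Submodule k (TensorAlgebra k V)) m) := by
    classical
    rw [Submodule.mulLeftMap_eq_mulMap_comp]
    simp_rw [LinearMap.coe_comp, LinearEquiv.coe_coe, ← Function.comp_assoc,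
      EquivLike.injective_comp]
    exact (tpow_linearDisjoint_top k V d).injective.comp
      (Module.Flat.rTensor_preserves_injective_linearMap _ m.linearIndependent)
  have key : ∀ j, ∃ c : _ →₀ (⊤ : Submodule k (TensorAlgebra k V)),
      (∀ i, (c i : TensorAlgebra k V) ∈ U j) ∧ Submodule.mulLeftMap ⊤ m c = t := by
    intro j
    refine Submodule.mul_induction_on (h j) ?_ ?_
    · intro a ha u hu
      refine ⟨(m.repr ⟨a, ha⟩).mapRange (fun r => r • (⟨u, trivial⟩ : (⊤ : Submodule k _)))
        (zero_smul _ _), fun i => ?_, ?_⟩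
      · simpa using (U j).smul_mem _ hu
      · rw [Submodule.mulLeftMap_apply, Finsupp.sum_mapRange_index (by simp)]
        have := congrArg Subtype.val (m.linearCombination_repr ⟨a, ha⟩)
        rw [Finsupp.linearCombination_apply, Finsupp.sum] at this
        simp only [AddSubmonoidClass.coe_finsetSum, Submodule.coe_smul] at this
        rw [Finsupp.sum]
        conv_rhs => rw [← this, Finset.sum_mul]
        simp
    · rintro x y ⟨c, hc, rfl⟩ ⟨c', hc', rfl⟩
      exact ⟨c + c', fun i => by simpa using (U j).add_mem (hc i) (hc' i), by simp⟩
  choose c hc hct using key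
  obtain ⟨j₀⟩ := ‹Nonempty J›
  have hmem : ∀ i, (c j₀ i : TensorAlgebra k V) ∈ ⨅ j, U j := by
    intro i
    rw [Submodule.mem_iInf]
    intro j
    rw [hinj ((hct j₀).trans (hct j).symm)]
    exact hc j i
  rw [← hct j₀, Submodule.mulLeftMap_apply]
  exact Submodule.sum_mem _ fun i _ => Submodule.mul_mem_mul (m i).2 (hmem i)

/-- The algebra `A(V, R) = T(V) / I(R)`, with `I(R)` the two-sided ideal generated by `R`. -/
abbrev Alg (R : Submodule k (TensorAlgebra k V)) : Type _ :=
  TensorAlgebra k V ⧸ (TwoSidedIdeal.span (R : Set (TensorAlgebra k V))).asIdeal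

/-- `W_m = ⋂_{i + N + j = m} V^{⊗ i} ⊗ R ⊗ V^{⊗ j}` inside `V^{⊗ m}`
(so `W_m = V^{⊗ m}` for `m < N`). -/
def W (N : ℕ) (R : Submodule k (TensorAlgebra k V)) (m : ℕ) : Submodule k (TensorAlgebra k V) :=
  tpow k V m ⊓ ⨅ p : {p : ℕ × ℕ // p.1 + N + p.2 = m}, tpow k V p.1.1 * R * tpow k V p.1.2

/-- The inclusion `W_{d + m} ⊆ V^{⊗ d} ⊗ W_m`. -/
theorem W_add_le (N : ℕ) (R : Submodule k (TensorAlgebra k V)) (d m : ℕ) :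
    W N R (d + m) ≤ tpow k V d * W N R m := by
  intro t ht
  have hW : W N R m = ⨅ o : Option {p : ℕ × ℕ // p.1 + N + p.2 = m},
      o.elim (tpow k V m) (fun p => tpow k V p.1.1 * R * tpow k V p.1.2) := by
    rw [iInf_option]
    rfl
  rw [hW]
  refine mem_tpow_mul_iInf d _ t ?_
  rintro (_ | ⟨⟨i, j⟩, hp⟩)
  · have := ht.1
    rwa [tpow_add] at this
  · have := (Submodule.mem_iInf _).1 ht.2 ⟨(d + i, j), by simp only at hp ⊢; omega⟩
    simpa only [tpow_add, mul_assoc, Option.elim_some] using this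

/-- `ν_N(2i) = N i` and `ν_N(2i + 1) = N i + 1`. -/
def nu (N i : ℕ) : ℕ := N * (i / 2) + i % 2

theorem nu_le_succ {N : ℕ} (hN : 2 ≤ N) (i : ℕ) : nu N i ≤ nu N (i + 1) := by
  unfold nu
  rcases Nat.even_or_odd' i with ⟨c, rfl | rfl⟩
  · have h1 : (2 * c) / 2 = c := by omega
    have h2 : (2 * c + 1) / 2 = c := by omega
    rw [h1, h2]
    omega
  · have h1 : (2 * c + 1) / 2 = c := by omega
    have h2 : (2 * c + 1 + 1) / 2 = c + 1 := by omega
    rw [h1, h2, Nat.mul_add]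
    omega

/-- The inclusion `W_n ⊆ V^{⊗ (n - m)} ⊗ W_m` for `m ≤ n`, as a map to the tensor product. -/
def split (N : ℕ) (R : Submodule k (TensorAlgebra k V)) {m n : ℕ} (h : m ≤ n) :
    W N R n →ₗ[k] tpow k V (n - m) ⊗[k] W N R m :=
  (tpow_linearDisjoint k V (n - m) (W N R m)).mulMap.symm.toLinearMap ∘ₗ
    Submodule.inclusion (by
      have := W_add_le N R (n - m) m
      rwa [Nat.sub_add_cancel h] at this)

/-- The canonical map `V^{⊗ d} → A(V, R)`. -/
def toAlg (R : Submodule k (TensorAlgebra k V)) (d : ℕ) : tpow k V d →ₗ[k] Alg R :=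
  (Ideal.Quotient.mkₐ k
    (TwoSidedIdeal.span (R : Set (TensorAlgebra k V))).asIdeal).toLinearMap ∘ₗ
    (tpow k V d).subtype

/-- The term `K_i = A ⊗ W_{ν_N(i)}` of the Koszul complex, a left `A`-module. -/
abbrev K (N : ℕ) (R : Submodule k (TensorAlgebra k V)) (i : ℕ) : Type _ :=
  Alg R ⊗[k] W N R (nu N i)

/-- The differential `δ_{i+1} : K_{i+1} → K_i` of the Koszul complex: the left `A`-linear map
whose restriction to `W_{ν(i+1)}` is the composite
`W_{ν(i+1)} ⊆ V^{⊗ (ν(i+1) - ν(i))} ⊗ W_{ν(i)} → A ⊗ W_{ν(i)}`. -/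
def delta {N : ℕ} (hN : 2 ≤ N) (R : Submodule k (TensorAlgebra k V)) (i : ℕ) :
    K N R (i + 1) →ₗ[Alg R] K N R i :=
  TensorProduct.AlgebraTensorModule.lift <|
    LinearMap.toSpanSingleton (Alg R) (W N R (nu N (i + 1)) →ₗ[k] K N R i) <|
      (toAlg R (nu N (i + 1) - nu N i)).rTensor (W N R (nu N i)) ∘ₗ
        split N R (nu_le_succ hN i)

/-- `A(V, R)` is `N`-Koszul, for a space `R ⊆ V^{⊗ N}` of relations: the homology of the Koszul
complex vanishes in every degree `i + 1 > 0`, i.e. the kernel of `δ_{i+1}` is the image of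
`δ_{i+2}`. -/
def IsNKoszul {N : ℕ} (hN : 2 ≤ N) (R : Submodule k (TensorAlgebra k V)) : Prop :=
  R ≤ tpow k V N ∧ ∀ i : ℕ, Function.Exact (delta hN R (i + 1)) (delta hN R i)

/-- The monomial `x_{i_1} ⋯ x_{i_r}` in `T(V)` attached to a word `[i_1, …, i_r]`. -/
def monomial {n : ℕ} (x : Module.Basis (Fin n) k V) (w : List (Fin n)) : TensorAlgebra k V :=
  (w.map fun j => TensorAlgebra.ι k (x j)).prod

end NKoszul

end

/-! In the monomial basis of T(V), with F the word of f, the ideal I(R) is spanned by the words that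
contain F (`mem_ideal_iff`), and W_m by the words of length m whose windows of length N are all
equal to F (`mem_W_iff`). Exactness thus becomes a question about words. At K_1 = A ⊗ V it holds for
every F (`exact_delta_one_delta_zero`).

Suppose F is not constant. Two windows shifted by one letter cannot both be F, so W_m = 0 for m > N
and the complex stops at K_2 = A ⊗ kf. What remains is injectivity of a ⊗ f ↦ a x_{i_1}⋯x_{i_{N-1}}
⊗ x_{i_N}. If F = ub = bv with u, b nonempty, then u is nonzero in A and is killed. If there is no
such overlap, appending all but the last letter of F to a word creates no new occurrence of F, and
the map is injective (`exact_delta_two_delta_one_iff`).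

If F = a^N, then K_i for i ≥ 2 is A tensored with the line of a^{ν(i)}, and the differentials are
right multiplications by a and a^{N-1} in alternation. The right multiplication by a^d has kernel A
a^{N-d}, so the complex is exact (`exact_delta_replicate`).

Finally, F = ub = bv says that F has period |u|, which gives the form (x_{i_1}⋯x_{i_m})^q
x_{i_1}⋯x_{i_r} with m = |u| (`exists_period_iff`). -/

namespace NKoszul

/-! ### Combinatorics of words: overlaps, periods, occurrences -/

section Words

variable {α : Type*}

/-- A word is self-overlapping if it has a nonempty proper prefix that is also a suffix. -/
def SelfOverlapping (F : List α) : Prop :=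
  ∃ u b v : List α, u ≠ [] ∧ b ≠ [] ∧ F = u ++ b ∧ F = b ++ v

/-- Overlap gives period: if b is at least as long as u, then b = uc, where c is again a prefix of
uc. Peeling off copies of u ends with a proper prefix of u. -/
theorem eq_flatten_replicate_append_take {u b : List α} (hu : u ≠ []) (h : b <+: u ++ b) :
    ∃ q r, r < u.length ∧ b = (List.replicate q u).flatten ++ u.take r := by
  induction hl : b.length using Nat.strong_induction_on generalizing b with
  | _ l ih =>
    have hup : u <+: u ++ b := List.prefix_append _ _
    rcases lt_or_ge b.length u.length with hlt | hge
    · refine ⟨0, b.length, hlt, ?_⟩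
      simpa using List.prefix_iff_eq_take.1 (List.prefix_of_prefix_length_le h hup hlt.le)
    · obtain ⟨c, rfl⟩ := List.prefix_of_prefix_length_le hup h hge
      have hpos := List.length_pos_iff.2 hu
      obtain ⟨q, r, hr, hc⟩ := ih c.length (by simp at hl; omega)
        ((List.prefix_append_right_inj u).1 h) rfl
      exact ⟨q + 1, r, hr, by rw [List.replicate_succ]; simpa using hc⟩

theorem selfOverlapping_of_eq_flatten {F u : List α} {q r : ℕ} (hu : u ≠ [])
    (hlt : u.length < F.length) (hr : r < u.length)
    (h : F = (List.replicate q u).flatten ++ u.take r) : SelfOverlapping F := by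
  cases q with
  | zero =>
    have := congrArg List.length h
    simp at this
    omega
  | succ q =>
    -- The overlap is F without its first copy of u. Since u is its prefix of length r followed by
    -- the rest, v is u rotated by r letters.
    refine ⟨u, (List.replicate q u).flatten ++ u.take r, u.drop r ++ u.take r, hu, ?_, ?_, ?_⟩
    · intro h0
      rw [List.replicate_succ, List.flatten_cons, List.append_assoc, h0] at h
      simp [h] at hlt
    · rw [h, List.replicate_succ]; simp
    · rw [h, List.replicate_succ']
      conv_lhs => rw [List.flatten_append]
      simp only [List.flatten_cons, List.flatten_nil, List.append_nil, List.append_assoc]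
      rw [← List.append_assoc (u.take r), List.take_append_drop]

/-- An occurrence of F that ends inside the appended part would straddle the boundary, and its two
pieces would exhibit a self-overlap. The missing last letter excludes the occurrence that lies
wholly in the appended part. -/
theorem infix_of_infix_append_dropLast {F w : List α} (hF : F ≠ []) (hno : ¬ SelfOverlapping F)
    (h : F <:+: w ++ F.dropLast) : F <:+: w := by
  have hpos := List.length_pos_iff.2 hF
  rcases List.infix_append_iff.1 h with h | h | ⟨t₁, t₂, h, h₁, h₂⟩
  · exact h
  · have := h.length_le
    simp at this
    omega
  · rcases eq_or_ne t₂ [] with rfl | ht₂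
    · rw [List.append_nil] at h
      exact h ▸ h₁.isInfix
    · have hp : t₂ <+: F := h₂.trans (List.dropLast_prefix F)
      rcases eq_or_ne t₁ [] with rfl | ht₁
      · have := h₂.length_le
        rw [← show F = t₂ by simpa using h] at this
        simp at this
        omega
      · obtain ⟨v, hv⟩ := hp
        exact absurd ⟨t₁, t₂, v, ht₁, ht₂, h, hv.symm⟩ hno

/-- A straddling occurrence uses at most d letters of the appended part, so at least N - d letters a
end w. This computes the annihilator of a^d in the constant case. -/
theorem replicate_infix_append_replicate {N d : ℕ} (hd : d < N) {a : α} {w : List α}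
    (h : List.replicate N a <:+: w ++ List.replicate d a) :
    List.replicate N a <:+: w ∨ List.replicate (N - d) a <:+ w := by
  rcases List.infix_append_iff.1 h with h | h | ⟨t₁, t₂, h, h₁, h₂⟩
  · exact Or.inl h
  · have := h.length_le
    simp at this
    omega
  · right
    have hl := congrArg List.length h
    have hl₂ := h₂.length_le
    simp at hl hl₂
    obtain ⟨-, ht₁, -⟩ := List.append_eq_replicate_iff.1 h.symm
    refine List.IsSuffix.trans ?_ h₁
    rw [ht₁]
    exact ⟨List.replicate (t₁.length - (N - d)) a, by
      rw [List.replicate_append_replicate]; congr 1; omega⟩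

/-- Comparing letters, each letter of F equals the one before it, and the first equals a. -/
theorem eq_replicate_of_append_eq_cons {F v v' : List α} {a : α}
    (h : F ++ v = a :: (F ++ v')) : F = List.replicate F.length a := by
  induction F generalizing a v v' with
  | nil => rfl
  | cons c F ih =>
    simp only [List.cons_append, List.cons.injEq] at h
    obtain ⟨rfl, h⟩ := h
    rw [List.length_cons, List.replicate_succ, ← ih h]

theorem eq_replicate_of_forall_window {N m : ℕ} (hN : 1 ≤ N) (hm : N ≤ m) {a : α} {w : List α}
    (hw : ∀ i j, i + N + j = m → ∃ u v : List α, u.length = i ∧ v.length = j ∧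
      w = u ++ List.replicate N a ++ v) : w = List.replicate m a := by
  induction m, hm using Nat.le_induction generalizing w with
  | base =>
    obtain ⟨u, v, hu, hv, rfl⟩ := hw 0 0 (by omega)
    simp_all
  | succ m hm ih =>
    obtain ⟨u, v, hu, hv, rfl⟩ := hw 0 (m + 1 - N) (by omega)
    obtain rfl : u = [] := by simpa using hu
    obtain ⟨M, rfl⟩ : ∃ M, N = M + 1 := ⟨N - 1, by omega⟩
    simp only [List.nil_append, List.replicate_succ, List.cons_append] at hw ⊢
    refine congrArg (List.cons a) (ih ?_)
    intro i j hij
    obtain ⟨u', v', hu', hv', h⟩ := hw (i + 1) j (by omega)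
    obtain ⟨c, u', rfl⟩ : ∃ c u'', u' = c :: u'' := List.exists_cons_of_length_eq_add_one hu'
    simp only [List.cons_append, List.cons.injEq, List.append_assoc] at h
    exact ⟨u', v', by simpa using hu', hv', by simpa [List.replicate_succ] using h.2⟩

end Words

/-! ### The monomial basis of the tensor algebra -/

section Basis

variable {k : Type*} [Field k] {V : Type*} [AddCommGroup V] [Module k V]
  {n : ℕ} (x : Module.Basis (Fin n) k V)

/-- The basis of the tensor algebra that consists of the monomials. -/
noncomputable def monomialBasis : Module.Basis (List (Fin n)) k (TensorAlgebra k V) :=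
  x.tensorAlgebra.reindex FreeMonoid.toList

@[simp]
theorem monomialBasis_apply (w : List (Fin n)) : monomialBasis x w = monomial x w := by
  simp [monomialBasis, tensorAlgebra_apply, monomial]

@[simp]
theorem monomial_nil : monomial x [] = 1 := rfl

theorem monomial_append (v w : List (Fin n)) :
    monomial x (v ++ w) = monomial x v * monomial x w := by
  simp [monomial]

theorem monomial_injective : Function.Injective (monomial x) := by
  have := (monomialBasis x).injective
  simpa only [← funext (monomialBasis_apply x)] using this

theorem monomial_ne_zero (w : List (Fin n)) : monomial x w ≠ 0 := by
  rw [← monomialBasis_apply]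
  exact (monomialBasis x).ne_zero w

theorem monomial_pow (w : List (Fin n)) (q : ℕ) :
    monomial x w ^ q = monomial x (List.replicate q w).flatten := by
  induction q with
  | zero => simp
  | succ q ih => rw [pow_succ', ih, List.replicate_succ, List.flatten_cons, monomial_append]

theorem mem_span_monomial_iff {S : Set (List (Fin n))} {t : TensorAlgebra k V} :
    t ∈ Submodule.span k (monomial x '' S) ↔ ∀ w ∈ ((monomialBasis x).repr t).support, w ∈ S := by
  rw [← funext (monomialBasis_apply x), Module.Basis.mem_span_image]
  rfl

theorem span_range_monomial : Submodule.span k (Set.range (monomial x)) = ⊤ := by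
  rw [← funext (monomialBasis_apply x), Module.Basis.span_eq]

theorem tpow_eq_span_monomial (m : ℕ) :
    tpow k V m = Submodule.span k (monomial x '' {w | w.length = m}) := by
  rw [tpow_eq_span k V x]
  congr 1
  ext t
  simp only [Set.mem_range, Subtype.exists, Set.mem_image, Set.mem_ofPred_eq, tensorAlgebra_apply]
  exact Iff.rfl.trans ⟨fun ⟨w, hw, h⟩ => ⟨w.toList, hw, h⟩,
    fun ⟨w, hw, h⟩ => ⟨FreeMonoid.ofList w, hw, h⟩⟩

theorem monomial_mem_tpow {w : List (Fin n)} {m : ℕ} (h : w.length = m) :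
    monomial x w ∈ tpow k V m := by
  rw [tpow_eq_span_monomial x]
  exact Submodule.subset_span ⟨w, h, rfl⟩

theorem span_monomial_mul_span_monomial (S T : Set (List (Fin n))) :
    Submodule.span k (monomial x '' S) * Submodule.span k (monomial x '' T) =
      Submodule.span k (monomial x '' Set.image2 (· ++ ·) S T) := by
  rw [Submodule.span_mul_span, Set.image_image2, ← Set.image2_mul, Set.image2_image_left,
    Set.image2_image_right]
  simp only [monomial_append]

/-- Appending v is injective on words, so no cancellation occurs and vanishing of a product in A can
be tested word by word. -/
theorem repr_mul_monomial (t : TensorAlgebra k V) (w v : List (Fin n)) :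
    (monomialBasis x).repr (t * monomial x v) (w ++ v) = (monomialBasis x).repr t w := by
  have h : (Finsupp.lapply (w ++ v) ∘ₗ (monomialBasis x).repr.toLinearMap) ∘ₗ
      LinearMap.mulRight k (monomial x v) =
      Finsupp.lapply w ∘ₗ (monomialBasis x).repr.toLinearMap := by
    refine (monomialBasis x).ext fun u => ?_
    have : monomialBasis x u * monomial x v = monomialBasis x (u ++ v) := by
      simp [monomial_append]
    simp [this, -monomialBasis_apply, Finsupp.single_apply]
  exact LinearMap.congr_fun h t

end Basis

/-! ### The monomial ideal and the quotient algebra -/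

section Ideal

variable {k : Type*} [Field k] {V : Type*} [AddCommGroup V] [Module k V]
  {n : ℕ} (x : Module.Basis (Fin n) k V) (F : List (Fin n))

/-- The canonical projection from the tensor algebra to the algebra `T(V) / (f)`, where `f` is the
monomial of the word `F`. -/
noncomputable def proj :
    TensorAlgebra k V →ₐ[k] Alg (Submodule.span k {monomial x F}) :=
  Ideal.Quotient.mkₐ k _

theorem proj_surjective : Function.Surjective (proj x F) := Ideal.Quotient.mkₐ_surjective _ _

theorem toAlg_eq_proj (d : ℕ) (t : tpow k V d) :
    toAlg (Submodule.span k {monomial x F}) d t = proj x F t := rfl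

/-- Containing F survives multiplication by words on either side, so the span on the right is
already a two-sided ideal. -/
theorem mem_ideal_iff {t : TensorAlgebra k V} :
    t ∈ TwoSidedIdeal.span (Submodule.span k {monomial x F} : Set (TensorAlgebra k V)) ↔
      t ∈ Submodule.span k (monomial x '' {w | F <:+: w}) := by
  constructor
  · intro ht
    have htop : (⊤ : Submodule k (TensorAlgebra k V)) =
        Submodule.span k (monomial x '' Set.univ) := by
      rw [Set.image_univ, span_range_monomial]
    let I : TwoSidedIdeal (TensorAlgebra k V) :=
      .mk' (Submodule.span k (monomial x '' {w | F <:+: w}) : Submodule k (TensorAlgebra k V))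
        (zero_mem _) add_mem neg_mem
        (by
          intro a b hb
          have := Submodule.mul_mem_mul (Submodule.mem_top (R := k) (x := a)) hb
          rw [htop, span_monomial_mul_span_monomial] at this
          refine Submodule.span_mono (Set.image_mono ?_) this
          rintro _ ⟨u, -, v, hv, rfl⟩
          exact List.IsInfix.trans hv (List.suffix_append _ _).isInfix)
        (by
          intro a b ha
          have := Submodule.mul_mem_mul ha (Submodule.mem_top (R := k) (x := b))
          rw [htop, span_monomial_mul_span_monomial] at this
          refine Submodule.span_mono (Set.image_mono ?_) this
          rintro _ ⟨u, hu, v, -, rfl⟩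
          exact List.IsInfix.trans hu (List.prefix_append _ _).isInfix)
    have hI : ∀ s, s ∈ I ↔ s ∈ Submodule.span k (monomial x '' {w | F <:+: w}) := fun s =>
      TwoSidedIdeal.mem_mk' ..
    rw [← hI]
    refine TwoSidedIdeal.mem_span_iff.1 ht I fun s hs => (hI s).2 ?_
    refine (Submodule.span_le (p := Submodule.span k (monomial x '' {w | F <:+: w}))).2 ?_ hs
    rw [Set.singleton_subset_iff]
    exact Submodule.subset_span ⟨F, List.infix_rfl, rfl⟩
  · intro ht
    induction ht using Submodule.span_induction with
    | mem t ht =>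
      obtain ⟨w, ⟨u, v, rfl⟩, rfl⟩ := ht
      rw [monomial_append, monomial_append]
      exact TwoSidedIdeal.mul_mem_right _ _ _ (TwoSidedIdeal.mul_mem_left _ _ _
        (TwoSidedIdeal.subset_span (Submodule.mem_span_singleton_self _)))
    | zero => exact zero_mem _
    | add a b _ _ ha hb => exact add_mem ha hb
    | smul c a _ ha =>
      rw [Algebra.smul_def]
      exact TwoSidedIdeal.mul_mem_left _ _ _ ha

theorem proj_eq_zero_iff_mem {t : TensorAlgebra k V} :
    proj x F t = 0 ↔ t ∈ Submodule.span k (monomial x '' {w | F <:+: w}) := by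
  rw [← mem_ideal_iff]
  exact Ideal.Quotient.eq_zero_iff_mem.trans TwoSidedIdeal.mem_asIdeal

theorem proj_eq_zero_iff {t : TensorAlgebra k V} :
    proj x F t = 0 ↔ ∀ w ∈ ((monomialBasis x).repr t).support, F <:+: w :=
  (proj_eq_zero_iff_mem x F).trans (mem_span_monomial_iff x)

theorem proj_monomial_eq_zero_iff {w : List (Fin n)} :
    proj x F (monomial x w) = 0 ↔ F <:+: w := by
  rw [proj_eq_zero_iff, ← monomialBasis_apply, Module.Basis.repr_self,
    Finsupp.support_single _ one_ne_zero]
  simp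

theorem infix_append_of_proj_mul_monomial_eq_zero {t : TensorAlgebra k V} {v : List (Fin n)}
    (h : proj x F (t * monomial x v) = 0) :
    ∀ w ∈ ((monomialBasis x).repr t).support, F <:+: w ++ v := by
  intro w hw
  refine (proj_eq_zero_iff x F).1 h _ ?_
  rw [Finsupp.mem_support_iff, repr_mul_monomial]
  exact Finsupp.mem_support_iff.1 hw

/-- Words containing F vanish in A, and from the others the suffix u can be split off. -/
theorem exists_proj_eq_mul_monomial {t : TensorAlgebra k V} {u : List (Fin n)}
    (h : ∀ w ∈ ((monomialBasis x).repr t).support, F <:+: w ∨ u <:+ w) :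
    ∃ s, proj x F t = proj x F (s * monomial x u) := by
  have ht := (mem_span_monomial_iff x (S := {w | F <:+: w ∨ u <:+ w})).2 h
  clear h
  induction ht using Submodule.span_induction with
  | mem t ht =>
    obtain ⟨w, hw | ⟨v, rfl⟩, rfl⟩ := ht
    · exact ⟨0, by rw [zero_mul, map_zero, proj_monomial_eq_zero_iff]; exact hw⟩
    · exact ⟨monomial x v, by rw [monomial_append]⟩
  | zero => exact ⟨0, by simp⟩
  | add a b _ _ ha hb =>
    obtain ⟨s, hs⟩ := ha
    obtain ⟨s', hs'⟩ := hb
    exact ⟨s + s', by rw [map_add, hs, hs', add_mul, map_add]⟩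
  | smul c a _ ha =>
    obtain ⟨s, hs⟩ := ha
    exact ⟨c • s, by rw [map_smul, hs, smul_mul_assoc, map_smul]⟩

end Ideal

/-! ### The spaces W_m for one monomial relation -/

section W

variable {k : Type*} [Field k] {V : Type*} [AddCommGroup V] [Module k V]
  {n : ℕ} (x : Module.Basis (Fin n) k V)

theorem tpow_mul_span_monomial_mul_tpow (F : List (Fin n)) (a b : ℕ) :
    tpow k V a * Submodule.span k {monomial x F} * tpow k V b = Submodule.span k (monomial x ''
      {w | ∃ u v : List (Fin n), u.length = a ∧ v.length = b ∧ w = u ++ F ++ v}) := by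
  rw [tpow_eq_span_monomial x, tpow_eq_span_monomial x, ← Set.image_singleton,
    span_monomial_mul_span_monomial, span_monomial_mul_span_monomial]
  congr 2
  ext w
  simp only [Set.image2_singleton_right, Set.mem_image2, Set.mem_image, Set.mem_ofPred_eq]
  constructor
  · rintro ⟨_, ⟨u, hu, rfl⟩, v, hv, rfl⟩
    exact ⟨u, v, hu, hv, rfl⟩
  · rintro ⟨u, v, hu, hv, rfl⟩
    exact ⟨_, ⟨u, hu, rfl⟩, v, hv, rfl⟩

/-- All spaces being intersected are spanned by monomials, so membership is a condition on each word
of the support. -/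
theorem mem_W_iff {N : ℕ} {F : List (Fin n)} {m : ℕ} {t : TensorAlgebra k V} :
    t ∈ W N (Submodule.span k {monomial x F}) m ↔
      ∀ w ∈ ((monomialBasis x).repr t).support, w.length = m ∧ ∀ i j, i + N + j = m →
        ∃ u v : List (Fin n), u.length = i ∧ v.length = j ∧ w = u ++ F ++ v := by
  simp only [W, Submodule.mem_inf, Submodule.mem_iInf, tpow_mul_span_monomial_mul_tpow]
  simp only [mem_span_monomial_iff, tpow_eq_span_monomial x, Set.mem_ofPred_eq, Subtype.forall,
    Prod.forall]
  exact ⟨fun h w hw => ⟨h.1 w hw, fun i j hij => h.2 i j hij w hw⟩,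
    fun h => ⟨fun w hw => (h w hw).1, fun i j hij w hw => (h w hw).2 i j hij⟩⟩

theorem monomial_mem_W_iff {N : ℕ} {F : List (Fin n)} {m : ℕ} {w : List (Fin n)} :
    monomial x w ∈ W N (Submodule.span k {monomial x F}) m ↔
      w.length = m ∧ ∀ i j, i + N + j = m →
        ∃ u v : List (Fin n), u.length = i ∧ v.length = j ∧ w = u ++ F ++ v := by
  rw [mem_W_iff, ← monomialBasis_apply, Module.Basis.repr_self,
    Finsupp.support_single _ one_ne_zero]
  simp

theorem monomial_mem_W_of_lt {N : ℕ} {F : List (Fin n)} {m : ℕ} (hm : m < N) {w : List (Fin n)}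
    (hw : w.length = m) : monomial x w ∈ W N (Submodule.span k {monomial x F}) m :=
  (monomial_mem_W_iff x).2 ⟨hw, fun i j h => by omega⟩

theorem monomial_mem_W_self {F : List (Fin n)} :
    monomial x F ∈ W F.length (Submodule.span k {monomial x F}) F.length :=
  (monomial_mem_W_iff x).2 ⟨rfl, fun i j h => ⟨[], [], by simp; omega, by simp; omega, by simp⟩⟩

theorem monomial_replicate_mem_W {N m : ℕ} {a : Fin n} :
    monomial x (List.replicate m a) ∈
      W N (Submodule.span k {monomial x (List.replicate N a)}) m :=
  (monomial_mem_W_iff x).2 ⟨by simp, fun i j h => ⟨List.replicate i a, List.replicate j a,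
    by simp, by simp, by simp [← h]⟩⟩

/-- For m > N there are windows at positions 0 and 1. If both are F, then F is constant. -/
theorem W_eq_bot {F : List (Fin n)} (hF : ∀ a, F ≠ List.replicate F.length a) {m : ℕ}
    (hm : F.length < m) : W F.length (Submodule.span k {monomial x F}) m = ⊥ := by
  rw [eq_bot_iff]
  intro t ht
  rw [mem_W_iff] at ht
  rw [Submodule.mem_bot, ← (monomialBasis x).repr.map_eq_zero_iff, ← Finsupp.support_eq_empty,
    Finset.eq_empty_iff_forall_notMem]
  intro w hw
  obtain ⟨u, v, hu, hv, rfl⟩ := (ht w hw).2 0 (m - F.length) (by omega)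
  obtain ⟨u', v', hu', hv', h⟩ := (ht _ hw).2 1 (m - F.length - 1) (by omega)
  obtain rfl : u = [] := by simpa using hu
  obtain ⟨a, rfl⟩ := List.length_eq_one_iff.1 hu'
  exact hF a (eq_replicate_of_append_eq_cons (v := v) (v' := v') (by simpa using h))

theorem W_le_span_of_support {F g : List (Fin n)} {N m : ℕ}
    (h : ∀ w : List (Fin n), w.length = m → (∀ i j, i + N + j = m →
      ∃ u v : List (Fin n), u.length = i ∧ v.length = j ∧ w = u ++ F ++ v) → w = g) :
    W N (Submodule.span k {monomial x F}) m ≤ Submodule.span k {monomial x g} := by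
  intro t ht
  rw [mem_W_iff] at ht
  rw [← Set.image_singleton, mem_span_monomial_iff]
  exact fun w hw => h w (ht w hw).1 (ht w hw).2

theorem W_length_le {F : List (Fin n)} :
    W F.length (Submodule.span k {monomial x F}) F.length ≤ Submodule.span k {monomial x F} := by
  refine W_le_span_of_support x fun w _ h => ?_
  obtain ⟨u, v, hu, hv, rfl⟩ := h 0 0 (by omega)
  simp_all

theorem W_replicate_le {N m : ℕ} (hN : 1 ≤ N) (hm : N ≤ m) {a : Fin n} :
    W N (Submodule.span k {monomial x (List.replicate N a)}) m ≤
      Submodule.span k {monomial x (List.replicate m a)} :=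
  W_le_span_of_support x fun _ _ h => eq_replicate_of_forall_window hN hm h

end W

/-! ### Evaluating the Koszul differential -/

section Delta

variable {k : Type*} [Field k] {V : Type*} [AddCommGroup V] [Module k V]

/-- `split` inverts a multiplication map, so any one factorization of w determines its value. -/
theorem split_eq_tmul (N : ℕ) (R : Submodule k (TensorAlgebra k V)) {m n : ℕ} (h : m ≤ n)
    (w : W N R n) (p : tpow k V (n - m)) (g : W N R m) (hw : (w : TensorAlgebra k V) = p * g) :
    split N R h w = p ⊗ₜ[k] g := by
  rw [split, LinearMap.comp_apply]
  refine (LinearEquiv.symm_apply_eq _).2 (Subtype.ext ?_)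
  rw [Submodule.LinearDisjoint.val_mulMap_tmul]
  exact hw

theorem delta_tmul {N : ℕ} (hN : 2 ≤ N) (R : Submodule k (TensorAlgebra k V)) (i : ℕ)
    (a : Alg R) (w : W N R (nu N (i + 1))) (p : tpow k V (nu N (i + 1) - nu N i))
    (g : W N R (nu N i)) (hw : (w : TensorAlgebra k V) = p * g) :
    delta hN R i (a ⊗ₜ[k] w) = (a * toAlg R _ p) ⊗ₜ[k] g := by
  simp only [delta, TensorProduct.AlgebraTensorModule.lift_tmul, LinearMap.toSpanSingleton_apply,
    LinearMap.smul_apply, LinearMap.comp_apply, split_eq_tmul N R _ w p g hw,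
    LinearMap.rTensor_tmul, TensorProduct.smul_tmul', smul_eq_mul]

/-- Over a field some functional is nonzero at g. Applied to the second factor, it recovers a
nonzero multiple of a. -/
theorem tmul_eq_zero_iff_left {A M : Type*} [AddCommGroup A] [Module k A] [AddCommGroup M]
    [Module k M] {g : M} (hg : g ≠ 0) (a : A) : a ⊗ₜ[k] g = 0 ↔ a = 0 := by
  refine ⟨fun h => ?_, fun h => by rw [h, TensorProduct.zero_tmul]⟩
  obtain ⟨φ, hφ⟩ : ∃ φ : Module.Dual k M, φ g ≠ 0 := by
    by_contra! H
    exact hg ((Module.forall_dual_apply_eq_zero_iff k g).1 H)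
  have := congrArg ((TensorProduct.rid k A).toLinearMap ∘ₗ φ.lTensor A) h
  simpa [hφ] using this

theorem exists_eq_tmul_of_le_span {A T : Type*} [AddCommGroup A] [Module k A] [AddCommGroup T]
    [Module k T] {U : Submodule k T} (g : U) (hU : U ≤ Submodule.span k {(g : T)})
    (y : A ⊗[k] U) : ∃ a : A, y = a ⊗ₜ[k] g := by
  induction y with
  | zero => exact ⟨0, by simp⟩
  | tmul a u =>
    obtain ⟨c, hc⟩ := Submodule.mem_span_singleton.1 (hU u.2)
    refine ⟨c • a, ?_⟩
    rw [TensorProduct.smul_tmul]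
    congr 1
    exact Subtype.ext hc.symm
  | add y z hy hz =>
    obtain ⟨a, rfl⟩ := hy
    obtain ⟨b, rfl⟩ := hz
    exact ⟨a + b, by rw [TensorProduct.add_tmul]⟩

end Delta

/-! ### Exactness of the Koszul complex and the criterion -/

section Koszul

variable {k : Type*} [Field k] {V : Type*} [AddCommGroup V] [Module k V]
  {n : ℕ} (x : Module.Basis (Fin n) k V)

theorem nu_one (N : ℕ) : nu N 1 = 1 := by simp [nu]

theorem nu_two (N : ℕ) : nu N 2 = N := by simp [nu]

theorem nu_two_mul (N c : ℕ) : nu N (2 * c) = N * c := by simp [nu]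

theorem nu_two_mul_add_one (N c : ℕ) : nu N (2 * c + 1) = N * c + 1 := by
  have : (2 * c + 1) / 2 = c := by omega
  simp [nu, this]

theorem nu_monotone {N : ℕ} (hN : 2 ≤ N) : Monotone (nu N) :=
  monotone_nat_of_le_succ (nu_le_succ hN)

theorem nu_add_two (N i : ℕ) : nu N (i + 2) = nu N i + N := by
  simp [nu, Nat.mul_add]
  omega

theorem lt_nu_add_three {N : ℕ} (hN : 2 ≤ N) (i : ℕ) : N < nu N (i + 3) := by
  have h1 := nu_monotone hN (show 1 ≤ i + 1 by omega)
  rw [nu_one] at h1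
  rw [show i + 3 = i + 1 + 2 from rfl, nu_add_two]
  omega

theorem delta_monomial {N : ℕ} (hN : 2 ≤ N) {F : List (Fin n)} (i : ℕ) (t : TensorAlgebra k V)
    {w p g : List (Fin n)} (hwpg : w = p ++ g)
    (hw : monomial x w ∈ W N (Submodule.span k {monomial x F}) (nu N (i + 1)))
    (hg : monomial x g ∈ W N (Submodule.span k {monomial x F}) (nu N i)) :
    delta hN (Submodule.span k {monomial x F}) i (proj x F t ⊗ₜ[k] ⟨monomial x w, hw⟩) =
      proj x F (t * monomial x p) ⊗ₜ[k] ⟨monomial x g, hg⟩ := by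
  have hp : p.length = nu N (i + 1) - nu N i := by
    have h1 := ((monomial_mem_W_iff x).1 hw).1
    have h2 := ((monomial_mem_W_iff x).1 hg).1
    rw [hwpg, List.length_append] at h1
    omega
  rw [delta_tmul hN _ i _ _ ⟨monomial x p, monomial_mem_tpow x hp⟩ ⟨monomial x g, hg⟩
    (by simp [hwpg, monomial_append]), toAlg_eq_proj, map_mul]

/-- A cycle in A ⊗ V lifts to an element of I(R). A word containing F either ends in F, and yields a
boundary, or contains F before its last letter, and yields 0. -/
theorem exact_delta_one_delta_zero {N : ℕ} (hN : 2 ≤ N) {F : List (Fin n)} (hF : F.length = N) :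
    Function.Exact (delta hN (Submodule.span k {monomial x F}) 1)
      (delta hN (Submodule.span k {monomial x F}) 0) := by
  set R := Submodule.span k {monomial x F} with hR
  have hF0 : F ≠ [] := by rintro rfl; simp at hF; omega
  have hFcat : F = F.dropLast ++ [F.getLast hF0] := (List.dropLast_append_getLast hF0).symm
  have hfW : monomial x F ∈ W N R (nu N 2) := by
    subst hF; rw [nu_two]; exact monomial_mem_W_self x
  have hfle : W N R (nu N 2) ≤ Submodule.span k {monomial x F} := by
    subst hF; rw [nu_two]; exact W_length_le x
  have hlW : ∀ j, monomial x [j] ∈ W N R (nu N 1) := fun j =>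
    monomial_mem_W_of_lt x (by rw [nu_one]; omega) (by rw [nu_one]; rfl)
  have h1W : monomial x [] ∈ W N R (nu N 0) :=
    monomial_mem_W_of_lt x (by simp [nu]; omega) (by simp [nu])
  -- `D` detaches the last letter of a word. Its value at the empty word is immaterial, since words
  -- containing F are nonempty.
  let D : TensorAlgebra k V →ₗ[k] K N R 1 := (monomialBasis x).constr k fun w =>
    if h : w ≠ [] then proj x F (monomial x w.dropLast) ⊗ₜ[k]
      (⟨monomial x [w.getLast h], hlW _⟩ : W N R (nu N 1)) else 0
  have hDm : ∀ v j, D (monomial x (v ++ [j])) =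
      proj x F (monomial x v) ⊗ₜ[k] (⟨monomial x [j], hlW _⟩ : W N R (nu N 1)) := by
    intro v j
    rw [← monomialBasis_apply, Module.Basis.constr_basis]
    simp
  have hD : ∀ t j, D (t * monomial x [j]) =
      proj x F t ⊗ₜ[k] (⟨monomial x [j], hlW _⟩ : W N R (nu N 1)) := by
    intro t j
    have : D ∘ₗ LinearMap.mulRight k (monomial x [j]) =
        (TensorProduct.mk k _ (W N R (nu N 1))).flip ⟨monomial x [j], hlW _⟩ ∘ₗ
          (proj x F).toLinearMap := by
      refine (monomialBasis x).ext fun v => ?_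
      simpa [monomial_append] using hDm v j
    exact LinearMap.congr_fun this t
  have hlift : ∀ y : K N R 1, ∃ t, D t = y ∧
      delta hN R 0 y = proj x F t ⊗ₜ[k] ⟨monomial x [], h1W⟩ := by
    intro y
    induction y using TensorProduct.induction_on with
    | zero => exact ⟨0, by simp⟩
    | tmul a u =>
      obtain ⟨s, rfl⟩ := proj_surjective x F a
      have hle : Submodule.span k (monomial x '' {w | w.length = 1}) ≤ W N R (nu N 1) := by
        rw [Submodule.span_le]
        rintro _ ⟨w, hw, rfl⟩
        obtain ⟨j, rfl⟩ := List.length_eq_one_iff.1 hw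
        exact hlW j
      have hu : (u : TensorAlgebra k V) ∈
          Submodule.span k (monomial x '' {w : List (Fin n) | w.length = 1}) := by
        have htp : tpow k V (nu N 1) = _ := (congrArg _ (nu_one N)).trans (tpow_eq_span_monomial x 1)
        exact htp ▸ u.2.1
      have key : ∀ v (hv : v ∈ Submodule.span k (monomial x '' {w | w.length = 1})),
          ∃ t, D t = proj x F s ⊗ₜ[k] (⟨v, hle hv⟩ : W N R (nu N 1)) ∧
            delta hN R 0 (proj x F s ⊗ₜ[k] (⟨v, hle hv⟩ : W N R (nu N 1))) =
              proj x F t ⊗ₜ[k] ⟨monomial x [], h1W⟩ := by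
        intro v hv
        induction hv using Submodule.span_induction with
        | mem v hv =>
          obtain ⟨w, hw, rfl⟩ := hv
          obtain ⟨j, rfl⟩ := List.length_eq_one_iff.1 hw
          exact ⟨s * monomial x [j], hD s j, delta_monomial x hN 0 s (by simp) _ h1W⟩
        | zero =>
          have : (⟨0, hle (zero_mem _)⟩ : W N R (nu N 1)) = 0 := rfl
          exact ⟨0, by simp [this]⟩
        | add v v' hv hv' ih ih' =>
          obtain ⟨t, h, h'⟩ := ih
          obtain ⟨t', g, g'⟩ := ih'
          have : (⟨v + v', hle (add_mem hv hv')⟩ : W N R (nu N 1)) =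
            ⟨v, hle hv⟩ + ⟨v', hle hv'⟩ := rfl
          refine ⟨t + t', ?_, ?_⟩
          · rw [map_add, h, g, this, TensorProduct.tmul_add]
          · rw [this, TensorProduct.tmul_add, map_add, h', g', map_add, TensorProduct.add_tmul]
        | smul c v hv ih =>
          obtain ⟨t, h, h'⟩ := ih
          -- The scalar is moved into A, because the differential is linear over A.
          have : proj x F s ⊗ₜ[k] (⟨c • v, hle (Submodule.smul_mem _ c hv)⟩ : W N R (nu N 1)) =
            proj x F (algebraMap k _ c) • (proj x F s ⊗ₜ[k] (⟨v, hle hv⟩ : W N R (nu N 1))) := by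
            rw [TensorProduct.smul_tmul', smul_eq_mul, AlgHom.commutes, ← Algebra.smul_def,
              TensorProduct.smul_tmul]
            rfl
          refine ⟨c • t, ?_, ?_⟩
          · rw [map_smul, h, TensorProduct.smul_tmul', TensorProduct.smul_tmul]
            rfl
          · rw [this, map_smul, h', TensorProduct.smul_tmul', smul_eq_mul, ← map_mul,
              ← Algebra.smul_def]
      exact key u hu
    | add y z hy hz =>
      obtain ⟨t, h, h'⟩ := hy
      obtain ⟨t', g, g'⟩ := hz
      exact ⟨t + t', by rw [map_add, h, g],
        by rw [map_add, h', g', map_add, TensorProduct.add_tmul]⟩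
  have hδ : ∀ t, delta hN R 1 (proj x F t ⊗ₜ[k] ⟨monomial x F, hfW⟩) =
      proj x F (t * monomial x F.dropLast) ⊗ₜ[k] ⟨monomial x [F.getLast hF0], hlW _⟩ :=
    fun t => delta_monomial x hN 1 t hFcat _ _
  intro y
  constructor
  · intro hy
    obtain ⟨t, rfl, ht⟩ := hlift y
    rw [hy, eq_comm, tmul_eq_zero_iff_left
      (fun h => monomial_ne_zero x [] (congrArg Subtype.val h)), proj_eq_zero_iff_mem] at ht
    clear hy
    rw [← LinearMap.coe_range, SetLike.mem_coe]
    induction ht using Submodule.span_induction with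
    | mem t ht =>
      obtain ⟨w, hw, rfl⟩ := ht
      have hw0 : w ≠ [] := by rintro rfl; exact hF0 (by simpa using hw)
      obtain ⟨v, j, rfl⟩ := (List.eq_nil_or_concat' w).resolve_left hw0
      rcases List.infix_concat_iff.1 hw with ⟨u, hu⟩ | hv
      · refine ⟨proj x F (monomial x u) ⊗ₜ[k] ⟨monomial x F, hfW⟩, ?_⟩
        rw [hδ, ← hu, ← hD]
        conv_rhs => rw [hFcat, ← List.append_assoc, monomial_append, monomial_append]
      · rw [hDm, (proj_monomial_eq_zero_iff x F).2 hv, TensorProduct.zero_tmul]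
        exact zero_mem _
    | zero => rw [map_zero]; exact zero_mem _
    | add a b _ _ ha hb => rw [map_add]; exact add_mem ha hb
    | smul c a _ ha =>
      rw [map_smul]
      exact Submodule.smul_of_tower_mem _ c ha
  · rintro ⟨z, rfl⟩
    obtain ⟨a, rfl⟩ := exists_eq_tmul_of_le_span (⟨monomial x F, hfW⟩ : W N R (nu N 2))
      hfle z
    obtain ⟨t, rfl⟩ := proj_surjective x F a
    rw [hδ, delta_monomial x hN 0 _ (List.append_nil _).symm _ h1W, mul_assoc, ← monomial_append,
      ← hFcat, map_mul, (proj_monomial_eq_zero_iff x F).2 List.infix_rfl, mul_zero,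
      TensorProduct.zero_tmul]

theorem subsingleton_K {N : ℕ} (hN : 2 ≤ N) {F : List (Fin n)} (hF : F.length = N)
    (hc : ∀ a, F ≠ List.replicate N a) (i : ℕ) :
    Subsingleton (K N (Submodule.span k {monomial x F}) (i + 3)) := by
  subst hF
  have h := W_eq_bot x hc (lt_nu_add_three hN i)
  have : Subsingleton (W F.length (Submodule.span k {monomial x F}) (nu F.length (i + 3))) :=
    (Submodule.subsingleton_iff_eq_bot).2 h
  infer_instance

/-- Since K_3 = 0, exactness at K_2 means that the differential out of K_2 is injective. -/
theorem exact_delta_two_delta_one_iff {N : ℕ} (hN : 2 ≤ N) {F : List (Fin n)} (hF : F.length = N)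
    (hc : ∀ a, F ≠ List.replicate N a) :
    Function.Exact (delta hN (Submodule.span k {monomial x F}) 2)
      (delta hN (Submodule.span k {monomial x F}) 1) ↔ ¬ SelfOverlapping F := by
  set R := Submodule.span k {monomial x F} with hR
  have hF0 : F ≠ [] := by rintro rfl; simp at hF; omega
  have hFcat : F = F.dropLast ++ [F.getLast hF0] := (List.dropLast_append_getLast hF0).symm
  have hfW : monomial x F ∈ W N R (nu N 2) := by
    subst hF; rw [nu_two]; exact monomial_mem_W_self x
  have hfle : W N R (nu N 2) ≤ Submodule.span k {monomial x F} := by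
    subst hF; rw [nu_two]; exact W_length_le x
  have hlW : ∀ j, monomial x [j] ∈ W N R (nu N 1) := fun j =>
    monomial_mem_W_of_lt x (by rw [nu_one]; omega) (by rw [nu_one]; rfl)
  have hδ : ∀ t, delta hN R 1 (proj x F t ⊗ₜ[k] ⟨monomial x F, hfW⟩) =
      proj x F (t * monomial x F.dropLast) ⊗ₜ[k] ⟨monomial x [F.getLast hF0], hlW _⟩ :=
    fun t => delta_monomial x hN 1 t hFcat _ _
  have := subsingleton_K x hN hF hc 0
  constructor
  · rintro hex ⟨u, b, v, hu, hb, hub, hbv⟩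
    have hv : v ≠ [] := by
      rintro rfl
      have h1 := congrArg List.length hub
      have h2 := congrArg List.length hbv
      have := List.length_pos_iff.2 hu
      simp at h1 h2
      omega
    -- As v is nonempty, all but the last letter of F is b followed by v without its last letter.
    -- Putting u in front produces F = ub as a prefix.
    have h0 : delta hN R 1 (proj x F (monomial x u) ⊗ₜ[k] ⟨monomial x F, hfW⟩) = 0 := by
      rw [hδ, ← monomial_append, (proj_monomial_eq_zero_iff x F).2, TensorProduct.zero_tmul]
      conv_rhs => rw [hbv, List.dropLast_append_of_ne_nil hv, ← List.append_assoc, ← hub]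
      exact (List.prefix_append _ _).isInfix
    obtain ⟨z, hz⟩ := (hex _).1 h0
    rw [Subsingleton.elim z 0, map_zero, eq_comm, tmul_eq_zero_iff_left
      (fun h => monomial_ne_zero x F (congrArg Subtype.val h)), proj_monomial_eq_zero_iff] at hz
    -- The word u is too short to contain F, because b is nonempty.
    have h1 := hz.length_le
    have h2 := congrArg List.length hub
    have := List.length_pos_iff.2 hb
    simp at h2
    omega
  · intro hno y
    constructor
    · intro hy
      obtain ⟨a, rfl⟩ := exists_eq_tmul_of_le_span (⟨monomial x F, hfW⟩ : W N R (nu N 2))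
        hfle y
      obtain ⟨t, rfl⟩ := proj_surjective x F a
      rw [hδ, tmul_eq_zero_iff_left
        (fun h => monomial_ne_zero x _ (congrArg Subtype.val h))] at hy
      have ht : proj x F t = 0 := (proj_eq_zero_iff x F).2 fun w hw =>
        infix_of_infix_append_dropLast hF0 hno
          (infix_append_of_proj_mul_monomial_eq_zero x F hy w hw)
      exact ⟨0, by rw [map_zero, ht, TensorProduct.zero_tmul]⟩
    · rintro ⟨z, rfl⟩
      rw [Subsingleton.elim z 0, map_zero, map_zero]

/-- This covers degrees at least 2, where W is a line. In degree 1, W is all of V. -/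
theorem exact_delta_replicate {N : ℕ} (hN : 2 ≤ N) (a : Fin n) (i : ℕ) :
    Function.Exact (delta hN (Submodule.span k {monomial x (List.replicate N a)}) (i + 2))
      (delta hN (Submodule.span k {monomial x (List.replicate N a)}) (i + 1)) := by
  set R := Submodule.span k {monomial x (List.replicate N a)} with hR
  have hW : ∀ j, monomial x (List.replicate (nu N j) a) ∈ W N R (nu N j) := fun j =>
    monomial_replicate_mem_W x
  have hle : ∀ j, W N R (nu N (j + 2)) ≤
      Submodule.span k {monomial x (List.replicate (nu N (j + 2)) a)} := fun j =>
    W_replicate_le x (by omega) (by rw [nu_add_two]; omega)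
  have hmono := nu_monotone hN
  have hδ : ∀ j t, delta hN R j (proj x (List.replicate N a) t ⊗ₜ[k] ⟨_, hW (j + 1)⟩) =
      proj x (List.replicate N a) (t * monomial x (List.replicate (nu N (j + 1) - nu N j) a)) ⊗ₜ[k]
        ⟨_, hW j⟩ := fun j t =>
    delta_monomial x hN j t (by
      rw [List.replicate_append_replicate, Nat.sub_add_cancel (hmono (Nat.le_succ j))]) _ _
  set d := nu N (i + 1 + 1) - nu N (i + 1) with hd
  set d' := nu N (i + 2 + 1) - nu N (i + 2) with hd'
  -- Two consecutive steps of ν add up to N, and each step is positive.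
  have hdd : d < N ∧ d' = N - d := by
    have h1 := nu_add_two N (i + 1)
    have h2 := nu_add_two N i
    have h3 : nu N i < nu N (i + 1) := by
      rcases Nat.even_or_odd' i with ⟨c, rfl | rfl⟩
      · rw [nu_two_mul, nu_two_mul_add_one]; omega
      · rw [show 2 * c + 1 + 1 = 2 * (c + 1) by ring, nu_two_mul, nu_two_mul_add_one, mul_add]
        omega
    have h4 : nu N (i + 1) ≤ nu N (i + 2) := hmono (by omega)
    have h5 : nu N (i + 2) ≤ nu N (i + 3) := hmono (by omega)
    simp only [Nat.add_assoc, Nat.reduceAdd] at *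
    omega
  intro y
  constructor
  · intro hy
    obtain ⟨b, rfl⟩ := exists_eq_tmul_of_le_span (⟨_, hW (i + 2)⟩ : W N R (nu N (i + 2)))
      (hle i) y
    obtain ⟨t, rfl⟩ := proj_surjective x _ b
    rw [hδ (i + 1), tmul_eq_zero_iff_left
      (fun h => monomial_ne_zero x _ (congrArg Subtype.val h))] at hy
    obtain ⟨s, hs⟩ := exists_proj_eq_mul_monomial x (List.replicate N a) (t := t)
      (u := List.replicate d' a) fun w hw => by
        rw [hdd.2]
        exact replicate_infix_append_replicate hdd.1
          (infix_append_of_proj_mul_monomial_eq_zero x _ hy w hw)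
    exact ⟨proj x _ s ⊗ₜ[k] ⟨_, hW (i + 2 + 1)⟩, by rw [hδ (i + 2), hs]⟩
  · rintro ⟨z, rfl⟩
    obtain ⟨b, rfl⟩ := exists_eq_tmul_of_le_span (⟨_, hW (i + 3)⟩ : W N R (nu N (i + 3)))
      (hle (i + 1)) z
    obtain ⟨t, rfl⟩ := proj_surjective x _ b
    rw [hδ (i + 2), hδ (i + 1), mul_assoc, ← monomial_append, List.replicate_append_replicate,
      show d' + d = N by omega, map_mul, (proj_monomial_eq_zero_iff x _).2 List.infix_rfl,
      mul_zero, TensorProduct.zero_tmul]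

/-- The algebra of one monomial relation is `N`-Koszul if and only if the monomial is a power of a
single variable or does not overlap itself. -/
theorem isNKoszul_iff {N : ℕ} (hN : 2 ≤ N) {F : List (Fin n)} (hF : F.length = N) :
    IsNKoszul hN (Submodule.span k {monomial x F}) ↔
      (∃ a, F = List.replicate N a) ∨ ¬ SelfOverlapping F := by
  have hle : Submodule.span k {monomial x F} ≤ tpow k V N := by
    rw [Submodule.span_singleton_le_iff_mem]
    exact monomial_mem_tpow x hF
  constructor
  · rintro ⟨-, h⟩
    by_cases hc : ∃ a, F = List.replicate N a
    · exact Or.inl hc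
    · exact Or.inr ((exact_delta_two_delta_one_iff x hN hF (not_exists.1 hc)).1 (h 1))
  · intro h
    refine ⟨hle, fun i => ?_⟩
    by_cases hc : ∃ a, F = List.replicate N a
    · obtain ⟨a, rfl⟩ := hc
      rcases i with _ | i
      · exact exact_delta_one_delta_zero x hN hF
      · exact exact_delta_replicate x hN a i
    · have hno := h.resolve_left hc
      rcases i with _ | _ | i
      · exact exact_delta_one_delta_zero x hN hF
      · exact (exact_delta_two_delta_one_iff x hN hF (not_exists.1 hc)).2 hno
      · have := subsingleton_K x hN hF (not_exists.1 hc) i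
        intro y
        rw [Subsingleton.elim y 0]
        exact ⟨fun _ => ⟨0, map_zero _⟩, fun _ => map_zero _⟩

/-- A word is not constant and overlaps itself if and only if it has a period `m < N` with a
nonconstant initial segment of length `m`. -/
theorem exists_period_iff {N : ℕ} (hN : 2 ≤ N) (i : Fin N → Fin n) :
    (∃ m q r : ℕ, 2 ≤ m ∧ m ≤ N - 1 ∧ N = m * q + r ∧ r < m ∧
      monomial x (List.ofFn i) =
        monomial x ((List.ofFn i).take m) ^ q * monomial x ((List.ofFn i).take r) ∧
      ∃ s t : Fin N, (s : ℕ) < m ∧ (t : ℕ) < m ∧ i s ≠ i t) ↔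
    (¬ ∃ a, List.ofFn i = List.replicate N a) ∧ SelfOverlapping (List.ofFn i) := by
  have hlen : (List.ofFn i).length = N := List.length_ofFn
  simp only [monomial_pow, ← monomial_append, (monomial_injective x).eq_iff]
  constructor
  · rintro ⟨m, q, r, hm, hmN, hNm, hr, hf, s, t, hs, ht, hst⟩
    constructor
    · rintro ⟨a, ha⟩
      have key : ∀ s, i s = a := fun s =>
        (List.eq_replicate_iff.1 ha).2 _ (List.mem_ofFn.2 ⟨s, rfl⟩)
      exact hst ((key s).trans (key t).symm)
    · have hl : ((List.ofFn i).take m).length = m := by simp; omega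
      refine selfOverlapping_of_eq_flatten (u := (List.ofFn i).take m) (q := q) (r := r)
        (by rw [← List.length_pos_iff]; omega) (by omega) (by omega) ?_
      rwa [List.take_take, min_eq_left hr.le]
  · rintro ⟨hc, u, b, v, hu, hb, hub, hbv⟩
    have hu' := List.length_pos_iff.2 hu
    have hb' := List.length_pos_iff.2 hb
    have hlub : u.length + b.length = N := by rw [← List.length_append, ← hub, hlen]
    obtain ⟨q, r, hr, hq⟩ := eq_flatten_replicate_append_take (u := u) (b := b) hu
      ⟨v, by rw [← hbv, hub]⟩
    have htake : (List.ofFn i).take u.length = u := by rw [hub, List.take_left']; rfl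
    have hF : List.ofFn i = (List.replicate (q + 1) u).flatten ++ u.take r := by
      rw [hub, List.replicate_succ, List.flatten_cons, List.append_assoc, ← hq]
    have hst : ∃ s t : Fin N, (s : ℕ) < u.length ∧ (t : ℕ) < u.length ∧ i s ≠ i t := by
      by_contra! H
      -- Every letter of F occurs in u, so a constant u would make F constant.
      refine hc ⟨i ⟨0, by omega⟩, List.eq_replicate_iff.2 ⟨hlen, fun c hcF => ?_⟩⟩
      have hcu : c ∈ u := by
        rw [hF, List.mem_append, List.mem_flatten] at hcF
        rcases hcF with ⟨l, hl, hcl⟩ | hcF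
        · rwa [List.eq_of_mem_replicate hl] at hcl
        · exact List.mem_of_mem_take hcF
      obtain ⟨j, hj, rfl⟩ := List.mem_iff_getElem.1 hcu
      have : u[j] = i ⟨j, by omega⟩ := by
        have h : (List.ofFn i)[j]'(by omega) = u[j] := by
          simp only [hub, List.getElem_append_left hj]
        rw [← h, List.getElem_ofFn]
      rw [this]
      exact H _ _ hj hu'
    -- F = ub has one more copy of u than b. Nonconstancy of u gives m ≥ 2, and b being nonempty
    -- gives m ≤ N - 1.
    refine ⟨u.length, q + 1, r, ?_, by omega, ?_, hr, ?_, hst⟩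
    · obtain ⟨s, t, hs, ht, hne⟩ := hst
      by_contra hlt
      exact hne (congrArg i (Fin.ext (by omega)))
    · have := congrArg List.length hF
      rw [hlen] at this
      simp at this
      rw [this, min_eq_left hr.le, mul_comm]
    · have hr' : (List.ofFn i).take r = u.take r := by
        rw [hub, List.take_append_of_le_length hr.le]
      rw [htake, hr']
      exact hF

end Koszul

end NKoszul

theorem mainTheorem4 {k : Type*} [Field k] {V : Type*} [AddCommGroup V] [Module k V]
    {n : ℕ} (x : Module.Basis (Fin n) k V) {N : ℕ} (hN : 2 ≤ N) (i : Fin N → Fin n) :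
    NKoszul.IsNKoszul hN (Submodule.span k {NKoszul.monomial x (List.ofFn i)}) ↔
      ¬ ∃ m q r : ℕ, 2 ≤ m ∧ m ≤ N - 1 ∧ N = m * q + r ∧ r < m ∧
        NKoszul.monomial x (List.ofFn i) =
          NKoszul.monomial x ((List.ofFn i).take m) ^ q *
            NKoszul.monomial x ((List.ofFn i).take r) ∧
        ∃ s t : Fin N, (s : ℕ) < m ∧ (t : ℕ) < m ∧ i s ≠ i t := by
  rw [NKoszul.exists_period_iff x hN, NKoszul.isNKoszul_iff x hN List.length_ofFn]
  tauto
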